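/- Let $B$ be a stationary Bratteli diagram: every level $k\ge 1$ has the same finite vertex set $V$, there are $F_{vw}\in\{0,1,2,\dots\}$ edges from the vertex $w$ of level $k$ to the vertex $v$ of level $k+1$ for every $k\ge 1$, the top vertex (level $0$) is joined to each vertex of level $1$ by exactly one edge, and no row and no column of the incidence matrix $F$ is zero. Let $X_B$ be the compact space of infinite paths starting at the top vertex. Say that $w$ has access to $v$ if there is a directed path (possibly of length $0$) from $w$ to $v$; a class is an equivalence class of mutual access. Let $\lambda$ be a distinguished eigenvalue of $A=F^{T}$ with corresponding distinguished class $\alpha$: there is a vector $x=(x_v)_{v\in V}$ with $x_v\ge 0$, $\sum_v x_v=1$, $Ax=\lambda x$, and $x_v>0$ exactly when $v$ has access to $\alpha$. Let $\mu$ be the Borel measure on $X_B$ determined by $\lambda$ and $x$, i.e. the set of all paths that begin with a given finite path from the top vertex to the vertex $v$ of level $k\ge 1$ has measure $x_v/\lambda^{k-1}$. Let $X_\alpha\subset X_B$ be the set of paths that eventually stay in $\alpha$, and let $\omega X_\alpha$ be its one-point compactification, with the measure that extends $\mu|_{X_\alpha}$ and gives the point at infinity measure $0$. Call a measure $\nu$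 on a space good if for all compact open sets $U,V$ with $\nu(U)<\nu(V)$ there is a compact open set $W\subset V$ with $\nu(W)=\nu(U)$. Suppose that the vertices at which $x$ is nonzero can be labelled $1,2,\dots,n$ so that $\alpha=\{2,\dots,n\}$ (in particular $1\notin\alpha$). Then $\mu$ is good on $X_B$ if and only if $\mu$ is good on $\omega X_\alpha$. -/

import Mathlib

open MeasureTheory Topology

/-- A measure on a (locally compact, zero-dimensional) space is good if for all compact open sets
`V` and `U` with `μ U < μ V` there is a compact open `W ⊆ V` with `μ W = μ U`. -/
def IsGoodMeasure {X : Type*} [TopologicalSpace X] [MeasurableSpace X] (μ : Measure X) : Prop :=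
  ∀ V : Set X, IsCompact V → IsOpen V → ∀ U : Set X, IsCompact U → IsOpen U → μ U < μ V →
    ∃ W : Set X, IsCompact W ∧ IsOpen W ∧ W ⊆ V ∧ μ W = μ U

/-- The one-point compactification carries its Borel σ-algebra. -/
instance OnePoint.instMeasurableSpaceBorel {X : Type*} [TopologicalSpace X] :
    MeasurableSpace (OnePoint X) := borel (OnePoint X)

instance OnePoint.instBorelSpaceBorel {X : Type*} [TopologicalSpace X] :
    BorelSpace (OnePoint X) := ⟨rfl⟩

/-- A stationary Bratteli diagram whose levels `1, 2, 3, …` all have vertex set `V`.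
`F v w` is the number of edges from the vertex `w` of level `k` to the vertex `v` of level `k + 1`,
for every `k ≥ 1`. The top vertex of level `0` is joined to each vertex of level `1` by exactly one
edge; that edge carries no information and is left implicit. Every vertex has an outgoing edge, and
every vertex of level at least `2` has an incoming one. -/
structure StationaryBratteliDiagram (V : Type*) [Fintype V] where
  F : Matrix V V ℕ
  exists_in : ∀ v, ∃ w, F v w ≠ 0
  exists_out : ∀ w, ∃ v, F v w ≠ 0

namespace StationaryBratteliDiagram

variable {V : Type*} [Fintype V]

/-- The edges between two consecutive levels, with multiplicity. -/
structure Edge (B : StationaryBratteliDiagram V) where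
  src : V
  tgt : V
  idx : Fin (B.F tgt src)

instance (B : StationaryBratteliDiagram V) : TopologicalSpace B.Edge := ⊥

instance (B : StationaryBratteliDiagram V) : DiscreteTopology B.Edge := ⟨rfl⟩

/-- The path space `X_B`: infinite paths from the top vertex, where `p n` is the edge from level
`n + 1` to level `n + 2`; the topology is induced from the product of discrete spaces. -/
def Path (B : StationaryBratteliDiagram V) : Type _ :=
  {p : ℕ → B.Edge // ∀ n, (p n).tgt = (p (n + 1)).src}

instance (B : StationaryBratteliDiagram V) : TopologicalSpace B.Path :=
  inferInstanceAs (TopologicalSpace {p : ℕ → B.Edge // ∀ n, (p n).tgt = (p (n + 1)).src})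

instance (B : StationaryBratteliDiagram V) : MeasurableSpace B.Path := borel B.Path

instance (B : StationaryBratteliDiagram V) : BorelSpace B.Path := ⟨rfl⟩

/-- The vertex of level `n + 1` through which the path passes. -/
def Path.vertex {B : StationaryBratteliDiagram V} (p : B.Path) (n : ℕ) : V := (p.1 n).src

/-- All paths that agree with `p` from the top vertex down to level `n + 1`. -/
def cylinder {B : StationaryBratteliDiagram V} (p : B.Path) (n : ℕ) : Set B.Path :=
  {q | q.vertex 0 = p.vertex 0 ∧ ∀ i < n, q.1 i = p.1 i}

/-- `w` has access to `v`: there is a directed path of length at least `0` from `w` to `v`. -/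
def Access (B : StationaryBratteliDiagram V) : V → V → Prop :=
  Relation.ReflTransGen fun w v => B.F v w ≠ 0

/-- A class of vertices: an equivalence class of the relation of mutual access. -/
def IsVertexClass (B : StationaryBratteliDiagram V) (α : Set V) : Prop :=
  ∃ v, α = {w | B.Access v w ∧ B.Access w v}

/-- The vertices that have access to some vertex of `α`. -/
def accessSet (B : StationaryBratteliDiagram V) (α : Set V) : Set V :=
  {w | ∃ v ∈ α, B.Access w v}

/-- The class `α` is distinguished, with distinguished eigenvalue `lam` of `A = Fᵀ` and
corresponding normalized nonnegative eigenvector `x`, whose nonzero entries are those at the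
vertices that have access to `α`. These conditions force `lam` to be the Perron eigenvalue of the
block of `A` on `α`, and to be larger than the spectral radius of the block on any other class
that has access to `α`. -/
structure IsDistinguished (B : StationaryBratteliDiagram V) (α : Set V) (lam : ℝ)
    (x : V → ℝ) : Prop where
  isVertexClass : B.IsVertexClass α
  nonneg : ∀ v, 0 ≤ x v
  sum_eq_one : ∑ v, x v = 1
  eigen : Matrix.mulVec (B.F.transpose.map (Nat.cast : ℕ → ℝ)) x = lam • x
  pos_iff : ∀ v, 0 < x v ↔ v ∈ B.accessSet α

/-- `μ` is the Borel measure on `X_B` determined by `lam` and `x`: a cylinder given by a finite path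
from the top vertex to the vertex `v` of level `k` has measure `x v / lam ^ (k - 1)`. -/
def IsMeasureOf (B : StationaryBratteliDiagram V) (lam : ℝ) (x : V → ℝ)
    (μ : Measure B.Path) : Prop :=
  ∀ (p : B.Path) (n : ℕ), μ (cylinder p n) = ENNReal.ofReal (x (p.vertex n) / lam ^ n)

/-- `X_α`: the paths that are cofinal with a path running through vertices of `α` only, that is,
the paths that eventually stay in `α`. -/
def classPaths (B : StationaryBratteliDiagram V) (α : Set V) : Set B.Path :=
  {p | ∃ q : B.Path, (∀ n, q.vertex n ∈ α) ∧ ∃ N, ∀ n ≥ N, p.1 n = q.1 n}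

/-- The measure on `ωX_α` that extends the restriction of `μ` to `X_α` and gives the point at
infinity measure zero. -/
noncomputable def onePointExtension (B : StationaryBratteliDiagram V) (α : Set V)
    (μ : Measure B.Path) : Measure (OnePoint (B.classPaths α)) :=
  Measure.map (fun p : B.classPaths α => (p : OnePoint (B.classPaths α)))
    (Measure.comap (Subtype.val : B.classPaths α → B.Path) μ)

end StationaryBratteliDiagram

/-! Almost every path lies in `X_α`: away from weight-zero vertices a path either enters `α` and
stays there, or sits at `v₁` forever. The latter is a null event, since the eigenvector equation at
`v₁` forces fewer than `lam` loops there (`loops_lt`). `X_α` is exhausted by the pieces on which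
level `N + 1` already lies in `α`. These are compact and relatively open in `X_α`, so compact open
sets of `ωX_α` are traces of clopen sets of `X_B` with the same measure.

If `μ` is good on `X_B`, then cutting the larger set down to a late piece makes the subset supplied
by goodness compact in `X_α`.

Conversely, the two spaces must have the same values to attain. Clopen sets of `X_B` have measures
in the monoid generated by all `x v / lam ^ k` with `v` in the support; sets compact in `X_α` only
use `v ∈ α`. The complement in `ωX_α` of the paths starting in `α` is a neighbourhood of infinity of
mass `x v₁`. Goodness copies this mass to a set missing infinity, so `x v₁` belongs to the smaller
monoid (`ofReal_mem_weightMonoid`) and the monoids agree. Every element of it below the total mass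
is attained by a compact open subset of `X_α` (`exists_isClopen_of_mem_weightMonoid`), and goodness
moves that set into the given clopen set. -/

namespace StationaryBratteliDiagram

/-! ### Topology of the path space. -/

section PathSpace

variable {V : Type*} [Fintype V] {B : StationaryBratteliDiagram V}

instance : Finite B.Edge :=
  Finite.of_injective
    (β := Σ e : V × V, Fin (B.F e.1 e.2)) (fun e => ⟨(e.tgt, e.src), e.idx⟩) (by
      rintro ⟨s, t, i⟩ ⟨s', t', i'⟩ h
      simp only [Sigma.mk.injEq, Prod.mk.injEq] at h
      obtain ⟨⟨rfl, rfl⟩, h⟩ := h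
      rw [eq_of_heq h])

lemma continuous_edge (n : ℕ) : Continuous fun p : B.Path => p.1 n :=
  (continuous_apply n).comp continuous_subtype_val

instance : CompactSpace B.Path :=
  isCompact_iff_compactSpace.1 (IsClosed.isCompact (by
    have : {p : ℕ → B.Edge | ∀ n, (p n).tgt = (p (n + 1)).src} =
        ⋂ n, (fun p : ℕ → B.Edge => (p n, p (n + 1))) ⁻¹' {e | e.1.tgt = e.2.src} := by
      ext p; simp
    change IsClosed {p : ℕ → B.Edge | ∀ n, (p n).tgt = (p (n + 1)).src}
    rw [this]
    exact isClosed_iInter fun n => (isClosed_discrete _).preimage (by fun_prop)))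

instance : T2Space B.Path :=
  inferInstanceAs (T2Space {p : ℕ → B.Edge // ∀ n, (p n).tgt = (p (n + 1)).src})

instance : TotallyDisconnectedSpace B.Path :=
  inferInstanceAs
    (TotallyDisconnectedSpace {p : ℕ → B.Edge // ∀ n, (p n).tgt = (p (n + 1)).src})

instance : SecondCountableTopology B.Edge :=
  DiscreteTopology.secondCountableTopology_of_countable

instance : SecondCountableTopology B.Path :=
  (IsEmbedding.subtypeVal (X := ℕ → B.Edge)
    (p := fun p => ∀ n, (p n).tgt = (p (n + 1)).src)).secondCountableTopology

lemma isClopen_vertex_mem (n : ℕ) (S : Set V) : IsClopen {p : B.Path | p.vertex n ∈ S} :=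
  (isClopen_discrete {e : B.Edge | e.src ∈ S}).preimage (continuous_edge n)

lemma isClopen_cylinder (p : B.Path) (n : ℕ) : IsClopen (cylinder p n) := by
  have : cylinder p n = {q | q.vertex 0 ∈ ({p.vertex 0} : Set V)} ∩
      ⋂ i ∈ Finset.range n, {q : B.Path | q.1 i = p.1 i} := by
    ext q; simp [cylinder]
  rw [this]
  exact (isClopen_vertex_mem 0 _).inter (isClopen_biInter_finset fun i _ =>
    (isClopen_discrete {p.1 i}).preimage (continuous_edge i))

lemma self_mem_cylinder (p : B.Path) (n : ℕ) : p ∈ cylinder p n := ⟨rfl, fun _ _ => rfl⟩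

lemma cylinder_eq_of_mem {p q : B.Path} {n : ℕ} (h : q ∈ cylinder p n) :
    cylinder q n = cylinder p n := by
  ext r
  refine ⟨fun hr => ⟨hr.1.trans h.1, fun i hi => (hr.2 i hi).trans (h.2 i hi)⟩,
    fun hr => ⟨hr.1.trans h.1.symm, fun i hi => (hr.2 i hi).trans (h.2 i hi).symm⟩⟩

lemma cylinder_anti (p : B.Path) {m n : ℕ} (h : m ≤ n) : cylinder p n ⊆ cylinder p m :=
  fun _ hq => ⟨hq.1, fun i hi => hq.2 i (hi.trans_le h)⟩

lemma tgt_eq_vertex_succ (p : B.Path) (n : ℕ) : (p.1 n).tgt = p.vertex (n + 1) := p.2 n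

lemma vertex_eq_of_mem_cylinder {p q : B.Path} {n : ℕ} (h : q ∈ cylinder p n) {i : ℕ}
    (hi : i ≤ n) : q.vertex i = p.vertex i := by
  cases i with
  | zero => exact h.1
  | succ i => rw [← tgt_eq_vertex_succ, ← tgt_eq_vertex_succ, h.2 i hi]

lemma exists_cylinder_subset {O : Set B.Path} (hO : IsOpen O) {p : B.Path} (hp : p ∈ O) :
    ∃ n, cylinder p n ⊆ O := by
  obtain ⟨O', hO', rfl⟩ := isOpen_induced_iff.1 hO
  obtain ⟨_, ⟨y, n, rfl⟩, hy, hsub⟩ :=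
    (PiNat.isTopologicalBasis_cylinders (fun _ : ℕ => B.Edge)).exists_subset_of_mem_open
      (show p.1 ∈ O' from hp) hO'
  refine ⟨n, fun q hq => hsub ?_⟩
  rw [← PiNat.mem_cylinder_iff_eq.1 hy]
  exact fun i hi => hq.2 i hi

/-- A clopen set is a union of cylinders of one common length, as large as required. -/
lemma exists_forall_cylinder_subset {C : Set B.Path} (hC : IsClopen C) (N : ℕ) :
    ∃ n ≥ N, ∀ p ∈ C, cylinder p n ⊆ C := by
  let A : ℕ → Set B.Path := fun n => {p | cylinder p n ⊆ C}
  have hA : Monotone A := fun m n hmn p hp => (cylinder_anti p hmn).trans hp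
  obtain ⟨n, hn⟩ := hC.1.isCompact.elim_directed_cover A
    (fun n => isOpen_iff_mem_nhds.2 fun p hp => Filter.mem_of_superset
      ((isClopen_cylinder p n).2.mem_nhds (self_mem_cylinder p n)) fun q hq => by
        change cylinder q n ⊆ C
        rwa [cylinder_eq_of_mem hq])
    (fun p hp => Set.mem_iUnion.2 (exists_cylinder_subset hC.2 hp)) hA.directed_le
  exact ⟨max n N, le_max_right _ _, fun p hp => hA (le_max_left n N) (hn hp)⟩

/-- The vertex of level `1` and the first `n` edges of a path. -/
def initialSegment (n : ℕ) (p : B.Path) : V × (Fin n → B.Edge) :=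
  (p.vertex 0, fun i => p.1 i)

lemma initialSegment_preimage_singleton (n : ℕ) (p : B.Path) :
    initialSegment n ⁻¹' {initialSegment n p} = cylinder p n := by
  ext q
  simp only [initialSegment, Set.mem_preimage, Set.mem_singleton_iff, Prod.mk.injEq, cylinder,
    Set.mem_ofPred_eq, funext_iff, Fin.forall_iff]

lemma access_vertex (p : B.Path) {m n : ℕ} (h : m ≤ n) :
    B.Access (p.vertex m) (p.vertex n) := by
  induction n, h using Nat.le_induction with
  | base => exact .refl
  | succ n _ ih =>
    refine ih.tail ?_
    have := (p.1 n).idx.pos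
    rw [tgt_eq_vertex_succ] at this
    exact this.ne'

/-- A path starting at a given vertex and staying in a set each of whose vertices has an edge into
the set. -/
lemma exists_path_from {S : Set V} (hS : ∀ v ∈ S, ∃ w ∈ S, B.F w v ≠ 0) {v : V} (hv : v ∈ S) :
    ∃ p : B.Path, p.vertex 0 = v ∧ ∀ n, p.vertex n ∈ S := by
  choose f hf hF using fun v : S => hS v v.2
  let u : ℕ → S := fun n => (fun s : S => (⟨f s, hf s⟩ : S))^[n] ⟨v, hv⟩
  have hu : ∀ n, (u (n + 1) : V) = f (u n) := fun n => by
    simp only [u, Function.iterate_succ_apply']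
  refine ⟨⟨fun n => ⟨u n, u (n + 1), ⟨0, ?_⟩⟩, fun n => rfl⟩, rfl, fun n => (u n).2⟩
  rw [hu]
  exact Nat.pos_of_ne_zero (hF (u n))

/-- A path staying in a set each of whose vertices has an edge from the set extends backwards. -/
lemma exists_path_shift {S : Set V} (hS : ∀ v ∈ S, ∃ w ∈ S, B.F v w ≠ 0) (p : B.Path)
    (hp : ∀ n, p.vertex n ∈ S) (N : ℕ) :
    ∃ q : B.Path, (∀ n, q.vertex n ∈ S) ∧ ∀ n, q.1 (n + N) = p.1 n := by
  induction N with
  | zero => exact ⟨p, hp, fun _ => rfl⟩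
  | succ N ih =>
    obtain ⟨q, hq, hqp⟩ := ih
    obtain ⟨w, hw, hF⟩ := hS _ (hq 0)
    refine ⟨⟨fun n => Nat.casesOn n ⟨w, q.vertex 0, ⟨0, Nat.pos_of_ne_zero hF⟩⟩ fun k => q.1 k,
      fun n => ?_⟩, fun n => ?_, hqp⟩
    · cases n with
      | zero => rfl
      | succ k => exact q.2 k
    · cases n with
      | zero => exact hw
      | succ k => exact hq k

/-- Every vertex of `α` receives an edge from `α`, so a tail inside `α` extends backwards to a full
path inside `α`. -/
lemma mem_classPaths_iff {α : Set V} (hα : ∀ v ∈ α, ∃ w ∈ α, B.F v w ≠ 0) (p : B.Path) :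
    p ∈ B.classPaths α ↔ ∃ N, ∀ n ≥ N, p.vertex n ∈ α := by
  constructor
  · rintro ⟨q, hq, N, hN⟩
    refine ⟨N, fun n hn => ?_⟩
    have := hq n
    rwa [Path.vertex, ← hN n hn] at this
  · rintro ⟨N, hN⟩
    obtain ⟨q, hq, hqp⟩ := exists_path_shift hα
      ⟨fun n => p.1 (n + N), fun n => by rw [p.2 (n + N), Nat.add_right_comm]⟩
      (fun n => hN (n + N) (by omega)) N
    refine ⟨q, hq, N, fun n hn => ?_⟩
    have := hqp (n - N)
    rw [Nat.sub_add_cancel hn] at this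
    rw [this]
    change p.1 n = p.1 (n - N + N)
    rw [Nat.sub_add_cancel hn]

end PathSpace

end StationaryBratteliDiagram

namespace StationaryBratteliDiagram

/-! ### Consequences of the eigenvector equation. -/

section DistinguishedClass

variable {V : Type*} [Fintype V] {B : StationaryBratteliDiagram V} {lam : ℝ} {x : V → ℝ}
  {α : Set V} {v₁ : V}

lemma IsVertexClass.access (h : B.IsVertexClass α) {v w : V} (hv : v ∈ α) (hw : w ∈ α) :
    B.Access v w := by
  obtain ⟨u, rfl⟩ := h
  exact hv.2.trans hw.1

lemma IsVertexClass.mem_of_access (h : B.IsVertexClass α) {v w : V} (hv : v ∈ α)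
    (hvw : B.Access v w) (hw : w ∈ B.accessSet α) : w ∈ α := by
  obtain ⟨u', hu', hwu'⟩ := hw
  obtain ⟨u, rfl⟩ := h
  exact ⟨hv.1.trans hvw, hwu'.trans hu'.2⟩

namespace IsDistinguished

variable (hx : B.IsDistinguished α lam x)
include hx

lemma pos_of_mem {v : V} (hv : v ∈ α) : 0 < x v := (hx.pos_iff v).2 ⟨v, hv, .refl⟩

lemma mem_accessSet {v : V} (hv : x v ≠ 0) : v ∈ B.accessSet α :=
  (hx.pos_iff v).1 ((hx.nonneg v).lt_of_ne' hv)

lemma mem_of_access {v w : V} (hv : v ∈ α) (hvw : B.Access v w) (hw : x w ≠ 0) : w ∈ α :=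
  hx.isVertexClass.mem_of_access hv hvw (hx.mem_accessSet hw)

lemma sum_edges (v : V) : ∑ w, (B.F w v : ℝ) * x w = lam * x v := by
  simpa [Matrix.mulVec, dotProduct] using congr_fun hx.eigen v

lemma exists_edge_of_access {v : V} (hv : v ∉ α) (hs : {v | x v ≠ 0} = insert v α) :
    ∃ w ∈ α, B.F w v ≠ 0 := by
  have hxv : x v ≠ 0 := by
    have : v ∈ {v | x v ≠ 0} := hs ▸ Set.mem_insert v α
    exact this
  obtain ⟨u, hu, hvu⟩ := hx.mem_accessSet hxv
  -- All vertices on an access path into `α` have positive weight, so the first step that leaves `v`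
  -- must land in `α`.
  have key : ∀ y, B.Access y u → y = v → ∃ w ∈ α, B.F w v ≠ 0 := by
    intro y hy
    induction hy using Relation.ReflTransGen.head_induction_on with
    | refl => exact fun h => absurd (h ▸ hu) hv
    | @head y c hyc hcu ih =>
      rintro rfl
      have hc : c ∈ {v | x v ≠ 0} := ((hx.pos_iff c).2 ⟨u, hu, hcu⟩).ne'
      rw [hs] at hc
      exact hc.elim ih fun hc => ⟨c, hc, hyc⟩
  exact key v hvu rfl

/-- In the eigenvector equation at `v₁`, an edge into `α` contributes a positive term besides the
loops. -/
lemma loops_lt (hv₁ : v₁ ∉ α) (hs : {v | x v ≠ 0} = insert v₁ α) :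
    (B.F v₁ v₁ : ℝ) < lam := by
  have hpos : 0 < x v₁ := (hx.nonneg v₁).lt_of_ne' (by
    have : v₁ ∈ {v | x v ≠ 0} := hs ▸ Set.mem_insert v₁ α
    exact this)
  obtain ⟨w, hw, hF⟩ := hx.exists_edge_of_access hv₁ hs
  have hne : v₁ ≠ w := fun h => hv₁ (h ▸ hw)
  have h : (B.F v₁ v₁ : ℝ) * x v₁ < lam * x v₁ := by
    rw [← hx.sum_edges]
    refine Finset.single_lt_sum (f := fun w => (B.F w v₁ : ℝ) * x w) hne.symm
      (Finset.mem_univ _) (Finset.mem_univ w) ?_ fun k _ _ => ?_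
    · exact mul_pos (by exact_mod_cast Nat.pos_of_ne_zero hF) (hx.pos_of_mem hw)
    · exact mul_nonneg (Nat.cast_nonneg _) (hx.nonneg k)
  exact lt_of_mul_lt_mul_right h hpos.le

lemma exists_edge_into (hlam : 0 < lam) {v : V} (hv : v ∈ α) : ∃ w ∈ α, B.F w v ≠ 0 := by
  have h : ∑ w, (B.F w v : ℝ) * x w ≠ 0 := by
    rw [hx.sum_edges]
    exact (mul_pos hlam (hx.pos_of_mem hv)).ne'
  obtain ⟨w, -, hw⟩ := Finset.exists_ne_zero_of_sum_ne_zero h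
  have hF : B.F w v ≠ 0 := fun h => hw (by simp [h])
  exact ⟨w, hx.mem_of_access hv (.single hF) (right_ne_zero_of_mul hw), hF⟩

/-- Step from `v` into `α` and return by mutual access; the last edge of this nontrivial cycle is
the one sought. -/
lemma exists_edge_from (hlam : 0 < lam) {v : V} (hv : v ∈ α) : ∃ w ∈ α, B.F v w ≠ 0 := by
  obtain ⟨u, hu, hF⟩ := hx.exists_edge_into hlam hv
  obtain ⟨b, hvb, hb⟩ := Relation.TransGen.tail'_iff.1
    (Relation.TransGen.head' (r := fun w v => B.F v w ≠ 0) hF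
      (hx.isVertexClass.access hu hv))
  exact ⟨b, hx.isVertexClass.mem_of_access hv hvb ⟨v, hv, .single hb⟩, hb⟩

lemma nonempty : α.Nonempty := by
  obtain ⟨u, rfl⟩ := hx.isVertexClass
  exact ⟨u, .refl, .refl⟩

/-- Up to paths through vertices of weight zero, a path that meets `α` stays in `α`. -/
lemma vertex_mem_of_le {p : B.Path} (hp : ∀ n, x (p.vertex n) ≠ 0) {m n : ℕ} (h : m ≤ n)
    (hm : p.vertex m ∈ α) : p.vertex n ∈ α :=
  hx.mem_of_access hm (access_vertex p h) (hp n)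

lemma vertex_mem_of_mem_classPaths (hlam : 0 < lam) {p : B.Path} (hp : p ∈ B.classPaths α)
    {m n : ℕ} (h : m ≤ n) (hm : p.vertex m ∈ α) : p.vertex n ∈ α := by
  obtain ⟨N, hN⟩ := (mem_classPaths_iff (fun v => hx.exists_edge_from hlam) p).1 hp
  refine hx.mem_of_access hm (access_vertex p h) ((hx.pos_iff _).2
    ⟨_, hN (max n N) (le_max_right _ _), access_vertex p (le_max_left _ _)⟩).ne'

/-- The paths of `X_α` that lie in `α` from level `N + 1` on. -/
lemma classPaths_inter_eq (hlam : 0 < lam) (N : ℕ) :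
    B.classPaths α ∩ {p | p.vertex N ∈ α} = {p | ∀ n ≥ N, p.vertex n ∈ α} := by
  ext p
  refine ⟨fun h n hn => hx.vertex_mem_of_mem_classPaths hlam h.1 hn h.2, fun h => ⟨?_, h N le_rfl⟩⟩
  exact (mem_classPaths_iff (fun v => hx.exists_edge_from hlam) p).2 ⟨N, h⟩

/-- `X_α` itself need not be closed; these compact pieces exhaust it and make it locally compact. -/
lemma isClosed_classPaths_inter (hlam : 0 < lam) (N : ℕ) :
    IsClosed (B.classPaths α ∩ {p | p.vertex N ∈ α}) := by
  have : {p : B.Path | ∀ n ≥ N, p.vertex n ∈ α} = ⋂ n ≥ N, {p | p.vertex n ∈ α} := by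
    ext p; simp
  rw [hx.classPaths_inter_eq hlam, this]
  exact isClosed_biInter fun n _ => (isClopen_vertex_mem n α).1

lemma classPaths_eq_iUnion (hlam : 0 < lam) :
    B.classPaths α = ⋃ N, B.classPaths α ∩ {p | p.vertex N ∈ α} := by
  refine subset_antisymm (fun p hp => ?_) (Set.iUnion_subset fun N => Set.inter_subset_left)
  obtain ⟨N, hN⟩ := (mem_classPaths_iff (fun v => hx.exists_edge_from hlam) p).1 hp
  exact Set.mem_iUnion.2 ⟨N, hp, hN N le_rfl⟩

lemma monotone_classPaths_inter (hlam : 0 < lam) :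
    Monotone fun N => B.classPaths α ∩ {p | p.vertex N ∈ α} := fun _ _ hmn _ hp =>
  ⟨hp.1, hx.vertex_mem_of_mem_classPaths hlam hp.1 hmn hp.2⟩

lemma measurableSet_classPaths (hlam : 0 < lam) : MeasurableSet (B.classPaths α) := by
  rw [hx.classPaths_eq_iUnion hlam]
  exact MeasurableSet.iUnion fun N => (hx.isClosed_classPaths_inter hlam N).measurableSet

end IsDistinguished

end DistinguishedClass

/-! ### Null sets and the values of the measure. -/

section Measure

variable {V : Type*} [Fintype V] {B : StationaryBratteliDiagram V} {lam : ℝ} {x : V → ℝ}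
  {α : Set V} {v₁ : V} {μ : Measure B.Path} (hμ : B.IsMeasureOf lam x μ)
include hμ

lemma IsMeasureOf.isFiniteMeasure : IsFiniteMeasure μ := by
  have : IsFiniteMeasureOnCompacts μ := by
    have : IsLocallyFiniteMeasure μ := ⟨fun p => ⟨cylinder p 0,
      (isClopen_cylinder p 0).2.mem_nhds (self_mem_cylinder p 0), by
        rw [hμ]; exact ENNReal.ofReal_lt_top⟩⟩
    infer_instance
  exact ⟨isCompact_univ.measure_lt_top⟩

lemma IsMeasureOf.measure_vertex_eq_zero : μ {p | ∃ n, x (p.vertex n) = 0} = 0 := by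
  have : {p : B.Path | ∃ n, x (p.vertex n) = 0} = ⋃ n, {p | x (p.vertex n) = 0} := by
    ext p; simp
  rw [this]
  refine measure_iUnion_null fun n => measure_null_of_locally_null _ fun p hp => ⟨cylinder p n,
    mem_nhdsWithin_of_mem_nhds
      ((isClopen_cylinder p n).2.mem_nhds (self_mem_cylinder p n)), ?_⟩
  rw [hμ, show x (p.vertex n) = 0 from hp]
  simp

/-- The paths staying at a vertex with fewer than `lam` loops form a null set. -/
lemma IsMeasureOf.measure_constant_eq_zero (hv : (B.F v₁ v₁ : ℝ) < lam) (hxv : 0 ≤ x v₁) :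
    μ {p | ∀ n, p.vertex n = v₁} = 0 := by
  have hlam : 0 < lam := (Nat.cast_nonneg _).trans_lt hv
  -- There are `F v₁ v₁ ^ n` choices for the first `n` loops, each giving a set of measure at most
  -- `x v₁ / lam ^ n`.
  have key : ∀ n : ℕ, μ {p | ∀ n, p.vertex n = v₁} ≤
      ENNReal.ofReal ((B.F v₁ v₁ / lam) ^ n * x v₁) := by
    intro n
    let T : (Fin n → Fin (B.F v₁ v₁)) → Set B.Path := fun f =>
      {p | p.vertex 0 = v₁ ∧ ∀ i : Fin n, p.1 i = ⟨v₁, v₁, f i⟩}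
    have hsub : {p : B.Path | ∀ n, p.vertex n = v₁} ⊆ ⋃ f, T f := by
      intro p hp
      have : ∀ i : Fin n, ∃ j, p.1 i = ⟨v₁, v₁, j⟩ := by
        intro i
        have h1 : (p.1 i).src = v₁ := hp i
        have h2 : (p.1 i).tgt = v₁ := (tgt_eq_vertex_succ p i).trans (hp _)
        generalize p.1 i = e at h1 h2
        obtain ⟨s, t, j⟩ := e
        dsimp only at h1 h2
        subst h1 h2
        exact ⟨j, rfl⟩
      choose f hf using this
      exact Set.mem_iUnion.2 ⟨f, hp 0, hf⟩
    have hT : ∀ f, μ (T f) ≤ ENNReal.ofReal (x v₁ / lam ^ n) := by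
      intro f
      obtain h | ⟨p, hp⟩ := (T f).eq_empty_or_nonempty
      · simp [h]
      · have hc : T f ⊆ cylinder p n := fun q hq => ⟨hq.1.trans hp.1.symm, fun i hi =>
          (hq.2 ⟨i, hi⟩).trans (hp.2 ⟨i, hi⟩).symm⟩
        refine (measure_mono hc).trans_eq ?_
        have hvn : p.vertex n = v₁ := by
          cases n with
          | zero => exact hp.1
          | succ n => rw [← tgt_eq_vertex_succ, show p.1 n = _ from hp.2 (Fin.last n)]
        rw [hμ, hvn]
    refine (measure_mono hsub).trans ((measure_iUnion_fintype_le μ T).trans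
      ((Finset.sum_le_sum fun f _ => hT f).trans_eq ?_))
    rw [Finset.sum_const, ← ENNReal.ofReal_nsmul]
    congr 1
    simp only [Finset.card_univ, Fintype.card_fun, Fintype.card_fin, nsmul_eq_mul, Nat.cast_pow]
    rw [div_pow]
    ring
  have hlim : Filter.Tendsto (fun n : ℕ => ENNReal.ofReal ((B.F v₁ v₁ / lam) ^ n * x v₁))
      Filter.atTop (𝓝 0) := by
    have := (tendsto_pow_atTop_nhds_zero_of_lt_one (r := (B.F v₁ v₁ : ℝ) / lam)
      (by positivity) ((div_lt_one hlam).2 hv)).mul_const (x v₁)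
    simpa using ENNReal.tendsto_ofReal this
  exact le_antisymm (ge_of_tendsto' hlim key) zero_le

/-- Almost every path eventually stays in the distinguished class. -/
lemma IsMeasureOf.measure_compl_classPaths (hx : B.IsDistinguished α lam x) (hv₁ : v₁ ∉ α)
    (hs : {v | x v ≠ 0} = insert v₁ α) : μ (B.classPaths α)ᶜ = 0 := by
  have hloops := hx.loops_lt hv₁ hs
  have hlam : 0 < lam := (Nat.cast_nonneg _).trans_lt hloops
  refine measure_mono_null (t := {p | ∃ n, x (p.vertex n) = 0} ∪ {p | ∀ n, p.vertex n = v₁})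
    (fun p hp => ?_) (measure_union_null hμ.measure_vertex_eq_zero
      (hμ.measure_constant_eq_zero hloops (hx.nonneg v₁)))
  by_contra hcon
  simp only [Set.mem_union, Set.mem_ofPred_eq, not_or, not_exists, not_forall] at hcon
  obtain ⟨h0, N, hN⟩ := hcon
  have : p.vertex N ∈ {v | x v ≠ 0} := h0 N
  rw [hs] at this
  exact hp ((mem_classPaths_iff (fun v => hx.exists_edge_from hlam) p).2
    ⟨N, fun n hn => hx.vertex_mem_of_le h0 hn (this.resolve_left hN)⟩)

/-- The additive monoid generated by the measures of the cylinders ending in `S`. -/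
def weightMonoid (lam : ℝ) (x : V → ℝ) (S : Set V) : AddSubmonoid ENNReal :=
  AddSubmonoid.closure {t | ∃ v ∈ S, ∃ k : ℕ, t = ENNReal.ofReal (x v / lam ^ k)}

omit [Fintype V] hμ in
lemma mem_weightMonoid {S : Set V} {v : V} (hv : v ∈ S) (k : ℕ) :
    ENNReal.ofReal (x v / lam ^ k) ∈ weightMonoid lam x S :=
  AddSubmonoid.subset_closure ⟨v, hv, k, rfl⟩

omit [Fintype V] hμ in
-- Carries membership of `x v₁` over to all the generators `x v₁ / lam ^ k`.
lemma div_pow_mem_weightMonoid (hlam : 0 < lam) {S : Set V} {t : ENNReal}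
    (ht : t ∈ weightMonoid lam x S) (k : ℕ) :
    ENNReal.ofReal (1 / lam ^ k) * t ∈ weightMonoid lam x S := by
  induction ht using AddSubmonoid.closure_induction with
  | mem t h =>
    obtain ⟨v, hv, j, rfl⟩ := h
    rw [← ENNReal.ofReal_mul (by positivity)]
    convert mem_weightMonoid (lam := lam) (x := x) hv (k + j) using 2
    rw [pow_add]
    field_simp
  | zero => simp
  | add a b _ _ ha hb => rw [mul_add]; exact add_mem ha hb

/-- `C` splits into finitely many cylinders of a common length at least `N`; those ending at weight
zero contribute nothing. -/
lemma IsMeasureOf.measure_mem_weightMonoid {S : Set V} {C : Set B.Path} (hC : IsClopen C)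
    (N : ℕ) (hS : ∀ p ∈ C, ∀ n ≥ N, p.vertex n ∈ S ∨ x (p.vertex n) = 0) :
    μ C ∈ weightMonoid lam x S := by
  classical
  obtain ⟨n, hn, hcyl⟩ := exists_forall_cylinder_subset hC N
  have hfin : (initialSegment n '' C).Finite := Set.toFinite _
  have hpre : initialSegment n ⁻¹' (hfin.toFinset : Set (V × (Fin n → B.Edge))) = C := by
    rw [Set.Finite.coe_toFinset]
    refine subset_antisymm ?_ (Set.subset_preimage_image _ _)
    rintro q ⟨p, hp, hpq⟩
    refine hcyl p hp ?_
    rw [← initialSegment_preimage_singleton]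
    exact hpq.symm
  rw [← hpre, ← sum_measure_preimage_singleton]
  · refine sum_mem fun t ht => ?_
    obtain ⟨p, hp, rfl⟩ := hfin.mem_toFinset.1 ht
    rw [initialSegment_preimage_singleton, hμ]
    obtain h | h := hS p hp n hn
    · exact mem_weightMonoid h n
    · simp [h]
  · intro t ht
    obtain ⟨p, hp, rfl⟩ := hfin.mem_toFinset.1 ht
    rw [initialSegment_preimage_singleton]
    exact (isClopen_cylinder p n).2.measurableSet

end Measure

end StationaryBratteliDiagram

namespace StationaryBratteliDiagram

/-! ### Compact open sets of `ωX_α` and clopen sets of paths. -/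

section Compactification

variable {V : Type*} [Fintype V] {B : StationaryBratteliDiagram V} {lam : ℝ} {x : V → ℝ}
  {α : Set V} {v₁ : V} {μ : Measure B.Path}

/-- The part of a subset of `ωX_α` that lies in `X_α`, as a set of paths. -/
def pathTrace (B : StationaryBratteliDiagram V) (α : Set V)
    (K : Set (OnePoint (B.classPaths α))) : Set B.Path :=
  Subtype.val '' ((fun p : B.classPaths α => (p : OnePoint (B.classPaths α))) ⁻¹' K)

/-- The part of a set of paths that lies in `X_α`, as a subset of `ωX_α`. -/
def pathLift (B : StationaryBratteliDiagram V) (α : Set V) (C : Set B.Path) :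
    Set (OnePoint (B.classPaths α)) :=
  (fun p : B.classPaths α => (p : OnePoint (B.classPaths α))) '' (Subtype.val ⁻¹' C)

lemma pathTrace_pathLift (C : Set B.Path) :
    B.pathTrace α (B.pathLift α C) = C ∩ B.classPaths α := by
  rw [pathTrace, pathLift, Set.preimage_image_eq _ OnePoint.coe_injective,
    Subtype.image_preimage_coe, Set.inter_comm]

lemma pathTrace_mono {K L : Set (OnePoint (B.classPaths α))} (h : K ⊆ L) :
    B.pathTrace α K ⊆ B.pathTrace α L :=
  Set.image_mono (Set.preimage_mono h)

lemma pathLift_subset {C : Set B.Path} {K : Set (OnePoint (B.classPaths α))}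
    (h : C ∩ B.classPaths α ⊆ B.pathTrace α K) : B.pathLift α C ⊆ K := by
  rintro _ ⟨p, hp, rfl⟩
  obtain ⟨q, hq, hqp⟩ := h ⟨hp, p.2⟩
  rwa [← Subtype.ext hqp]

lemma infty_notMem_pathLift (C : Set B.Path) : OnePoint.infty ∉ B.pathLift α C :=
  fun ⟨_, _, h⟩ => OnePoint.coe_ne_infty _ h

lemma isOpen_pathLift {C : Set B.Path} (hC : IsClopen C) : IsOpen (B.pathLift α C) :=
  OnePoint.isOpenEmbedding_coe.isOpenMap _ (hC.2.preimage continuous_subtype_val)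

lemma isCompact_pathLift {C : Set B.Path} (hC : IsCompact (C ∩ B.classPaths α)) :
    IsCompact (B.pathLift α C) := by
  refine IsCompact.image (Subtype.isCompact_iff.2 ?_) OnePoint.continuous_coe
  rwa [Subtype.image_preimage_coe, Set.inter_comm]

lemma onePointExtension_apply (hY : MeasurableSet (B.classPaths α))
    {K : Set (OnePoint (B.classPaths α))} (hK : IsOpen K) :
    B.onePointExtension α μ K = μ (B.pathTrace α K) := by
  rw [onePointExtension, Measure.map_apply OnePoint.continuous_coe.measurable hK.measurableSet,
    comap_subtype_coe_apply hY, pathTrace]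

/-- The trace of `K` is compact in `X_B` and relatively open in `X_α`; zero-dimensionality puts a
clopen set between it and an open set that cuts it out. -/
lemma exists_isClopen_inter_eq_of_notMem {K : Set (OnePoint (B.classPaths α))}
    (hKc : IsCompact K) (hKo : IsOpen K) (hK : OnePoint.infty ∉ K) :
    ∃ C : Set B.Path, IsClopen C ∧ C ∩ B.classPaths α = B.pathTrace α K ∧
      IsCompact (C ∩ B.classPaths α) := by
  have hcomp : IsCompact (B.pathTrace α K) := by
    refine IsCompact.image ?_ continuous_subtype_val
    rw [OnePoint.isOpenEmbedding_coe.isInducing.isCompact_iff,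
      Set.image_preimage_eq_of_subset]
    · exact hKc
    · intro y hy
      exact OnePoint.ne_infty_iff_exists.1 fun h => hK (h ▸ hy)
  obtain ⟨O, hO, hOK⟩ := isOpen_induced_iff.1 (hKo.preimage OnePoint.continuous_coe)
  have hOK' : B.pathTrace α K = B.classPaths α ∩ O := by
    rw [pathTrace, ← hOK, Subtype.image_preimage_coe]
  obtain ⟨C, hC, hKC, hCO⟩ := exists_clopen_of_closed_subset_open hcomp.isClosed hO
    (hOK'.trans_subset Set.inter_subset_right)
  have h : C ∩ B.classPaths α = B.pathTrace α K := subset_antisymm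
    (fun p hp => hOK' ▸ ⟨hp.2, hCO hp.1⟩)
    fun p hp => ⟨hKC hp, (hOK'.subset hp).1⟩
  exact ⟨C, hC, h, h ▸ hcomp⟩

lemma IsDistinguished.t2Space_onePoint (hx : B.IsDistinguished α lam x) (hlam : 0 < lam) :
    T2Space (OnePoint (B.classPaths α)) := by
  have : WeaklyLocallyCompactSpace (B.classPaths α) := by
    refine ⟨fun p => ?_⟩
    obtain ⟨N, hN⟩ := Set.mem_iUnion.1 ((hx.classPaths_eq_iUnion hlam).subset p.2)
    refine ⟨Subtype.val ⁻¹' {p | p.vertex N ∈ α}, Subtype.isCompact_iff.2 ?_,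
      ((isClopen_vertex_mem N α).2.preimage continuous_subtype_val).mem_nhds hN.2⟩
    rw [Subtype.image_preimage_coe]
    exact (hx.isClosed_classPaths_inter hlam N).isCompact
  infer_instance

lemma IsDistinguished.exists_isClopen_inter_eq (hx : B.IsDistinguished α lam x) (hlam : 0 < lam)
    {K : Set (OnePoint (B.classPaths α))} (hKc : IsCompact K) (hKo : IsOpen K) :
    ∃ C : Set B.Path, IsClopen C ∧ C ∩ B.classPaths α = B.pathTrace α K := by
  by_cases hK : OnePoint.infty ∈ K
  · have := hx.t2Space_onePoint hlam
    obtain ⟨C, hC, hCK, -⟩ := exists_isClopen_inter_eq_of_notMem (K := Kᶜ)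
      -- Compact sets are closed because `ωX_α` is Hausdorff, so the complement is a compact open
      -- set missing infinity.
      hKo.isClosed_compl.isCompact hKc.isClosed.isOpen_compl (fun h => h hK)
    refine ⟨Cᶜ, hC.compl, ?_⟩
    ext p
    have h := Set.ext_iff.1 hCK p
    simp only [pathTrace, Set.mem_inter_iff, Set.mem_image, Set.mem_preimage, Subtype.exists,
      Set.mem_compl_iff, exists_and_right, exists_eq_right] at h ⊢
    by_cases hp : p ∈ B.classPaths α <;> simp_all
  · obtain ⟨C, hC, hCK, -⟩ := exists_isClopen_inter_eq_of_notMem hKc hKo hK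
    exact ⟨C, hC, hCK⟩

lemma measure_inter_classPaths (hnull : μ (B.classPaths α)ᶜ = 0) (C : Set B.Path) :
    μ (C ∩ B.classPaths α) = μ C :=
  measure_inter_conull hnull

lemma onePointExtension_pathLift (hY : MeasurableSet (B.classPaths α))
    (hnull : μ (B.classPaths α)ᶜ = 0) {C : Set B.Path} (hC : IsClopen C) :
    B.onePointExtension α μ (B.pathLift α C) = μ C := by
  rw [onePointExtension_apply hY (isOpen_pathLift hC), pathTrace_pathLift,
    measure_inter_classPaths hnull]

lemma onePointExtension_eq_measure (hY : MeasurableSet (B.classPaths α))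
    (hnull : μ (B.classPaths α)ᶜ = 0) {C : Set B.Path} {K : Set (OnePoint (B.classPaths α))}
    (hK : IsOpen K) (hCK : C ∩ B.classPaths α = B.pathTrace α K) :
    B.onePointExtension α μ K = μ C := by
  rw [onePointExtension_apply hY hK, ← hCK, measure_inter_classPaths hnull]

lemma IsDistinguished.exists_lt_measure_inter (hx : B.IsDistinguished α lam x) (hlam : 0 < lam)
    (hnull : μ (B.classPaths α)ᶜ = 0) {C : Set B.Path} {t : ENNReal} (ht : t < μ C) :
    ∃ N, t < μ (C ∩ {p | p.vertex N ∈ α}) := by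
  rw [← measure_inter_classPaths hnull, hx.classPaths_eq_iUnion hlam, Set.inter_iUnion,
    Monotone.measure_iUnion fun m n hmn =>
      Set.inter_subset_inter_right _ (hx.monotone_classPaths_inter hlam hmn)] at ht
  obtain ⟨N, hN⟩ := lt_iSup_iff.1 ht
  exact ⟨N, hN.trans_le (measure_mono (Set.inter_subset_inter_right _ Set.inter_subset_right))⟩

lemma IsDistinguished.isCompact_inter (hx : B.IsDistinguished α lam x) (hlam : 0 < lam)
    {C : Set B.Path} (hC : IsClopen C) (N : ℕ) :
    IsCompact (C ∩ {p | p.vertex N ∈ α} ∩ B.classPaths α) := by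
  rw [Set.inter_assoc, Set.inter_comm {p : B.Path | p.vertex N ∈ α}]
  exact (hC.1.inter (hx.isClosed_classPaths_inter hlam N)).isCompact

/-- If `μ` is good on `ωX_α`, then a clopen set of paths contains clopen sets, compact in `X_α`, of
every smaller measure that is attained on compact open subsets of `X_α`. -/
lemma exists_isClopen_subset (hx : B.IsDistinguished α lam x) (hlam : 0 < lam)
    (hnull : μ (B.classPaths α)ᶜ = 0) (hgood : IsGoodMeasure (B.onePointExtension α μ))
    {C : Set B.Path} (hC : IsClopen C) {K : Set (OnePoint (B.classPaths α))}
    (hKc : IsCompact K) (hKo : IsOpen K) (h : B.onePointExtension α μ K < μ C) :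
    ∃ W ⊆ C, IsClopen W ∧ IsCompact (W ∩ B.classPaths α) ∧
      μ W = B.onePointExtension α μ K := by
  have hY := hx.measurableSet_classPaths hlam
  -- Restricting to a late piece of `C` gives a target compact in `X_α`, so the set found by
  -- goodness misses infinity.
  obtain ⟨N, hN⟩ := hx.exists_lt_measure_inter hlam hnull h
  have hCN : IsClopen (C ∩ {p | p.vertex N ∈ α}) := hC.inter (isClopen_vertex_mem N α)
  rw [← onePointExtension_pathLift hY hnull hCN] at hN
  obtain ⟨L, hLc, hLo, hsub, hL⟩ := hgood _ (isCompact_pathLift (hx.isCompact_inter hlam hC N))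
    (isOpen_pathLift hCN) K hKc hKo hN
  obtain ⟨W, hW, hWL, hWc⟩ := exists_isClopen_inter_eq_of_notMem hLc hLo
    fun h => infty_notMem_pathLift _ (hsub h)
  have hWC : W ∩ C ∩ B.classPaths α = W ∩ B.classPaths α := by
    refine subset_antisymm (fun p hp => ⟨hp.1.1, hp.2⟩) fun p hp => ⟨⟨hp.1, ?_⟩, hp.2⟩
    have := pathTrace_mono hsub (hWL ▸ hp)
    rw [pathTrace_pathLift] at this
    exact this.1.1
  -- `W` is controlled only on `X_α`; cutting with `C` discards the rest without changing the trace.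
  refine ⟨W ∩ C, Set.inter_subset_right, hW.inter hC, hWC ▸ hWc, ?_⟩
  rw [← hL, onePointExtension_eq_measure hY hnull hLo (hWC.trans hWL)]

lemma exists_isClopen_of_mem_weightMonoid (hx : B.IsDistinguished α lam x) (hlam : 0 < lam)
    (hμ : B.IsMeasureOf lam x μ)
    (hnull : μ (B.classPaths α)ᶜ = 0) (hgood : IsGoodMeasure (B.onePointExtension α μ))
    {t : ENNReal} (ht : t ∈ weightMonoid lam x α) (hlt : t < μ Set.univ) :
    ∃ C : Set B.Path, IsClopen C ∧ IsCompact (C ∩ B.classPaths α) ∧ μ C = t := by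
  have := hμ.isFiniteMeasure
  induction ht using AddSubmonoid.closure_induction with
  | mem t h =>
    obtain ⟨v, hv, k, rfl⟩ := h
    obtain ⟨p, hpv, hp⟩ := exists_path_from (fun v => hx.exists_edge_into hlam) hv
    obtain ⟨q, hq, hqp⟩ := exists_path_shift (fun v => hx.exists_edge_from hlam) p hp k
    have hqk : q.vertex k = v := by
      rw [← hpv]
      have := hqp 0
      rw [Nat.zero_add] at this
      rw [Path.vertex, this, Path.vertex]
    have hsub : cylinder q k = cylinder q k ∩ {p | p.vertex k ∈ α} :=
      (Set.inter_eq_left.2 fun r hr => by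
        change r.vertex k ∈ α
        rw [vertex_eq_of_mem_cylinder hr le_rfl, hqk]
        exact hv).symm
    refine ⟨cylinder q k, isClopen_cylinder q k, ?_, by rw [hμ, hqk]⟩
    rw [hsub]
    exact hx.isCompact_inter hlam (isClopen_cylinder q k) k
  | zero => exact ⟨∅, isClopen_empty, by simp, by simp⟩
  | add a b _ _ ha hb =>
    obtain ⟨C, hC, hCc, rfl⟩ := ha (le_self_add.trans_lt hlt)
    obtain ⟨D, hD, hDc, rfl⟩ := hb (le_add_self.trans_lt hlt)
    have hY := hx.measurableSet_classPaths hlam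
    -- The sum is below the total mass, so a copy of `D` fits in the complement of `C`, which makes
    -- the union disjoint.
    have hlt' : B.onePointExtension α μ (B.pathLift α D) < μ Cᶜ := by
      rw [onePointExtension_pathLift hY hnull hD]
      rw [← measure_add_measure_compl hC.2.measurableSet] at hlt
      exact lt_of_add_lt_add_left hlt
    obtain ⟨W, hWC, hW, hWc, hμW⟩ := exists_isClopen_subset hx hlam hnull hgood hC.compl
      (isCompact_pathLift hDc) (isOpen_pathLift hD) hlt'
    refine ⟨C ∪ W, hC.union hW, ?_, ?_⟩
    · rw [Set.union_inter_distrib_right]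
      exact hCc.union hWc
    · rw [measure_union (Set.disjoint_left.2 fun p hp hpW => hWC hpW hp) hW.2.measurableSet, hμW,
        onePointExtension_pathLift hY hnull hD]

/-- Compactness places the trace of `C` in a single piece of the exhaustion; from that level on,
vertices of positive weight lie in `α`. -/
lemma IsMeasureOf.measure_mem_weightMonoid_of_isCompact (hμ : B.IsMeasureOf lam x μ)
    (hx : B.IsDistinguished α lam x) (hlam : 0 < lam) (hnull : μ (B.classPaths α)ᶜ = 0)
    {C : Set B.Path} (hC : IsClopen C) (hCc : IsCompact (C ∩ B.classPaths α)) :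
    μ C ∈ weightMonoid lam x α := by
  have hCc' : IsCompact (Subtype.val ⁻¹' C : Set (B.classPaths α)) := by
    rwa [Subtype.isCompact_iff, Subtype.image_preimage_coe, Set.inter_comm]
  obtain ⟨N, hN⟩ := hCc'.elim_directed_cover
    (fun N => Subtype.val ⁻¹' {p : B.Path | p.vertex N ∈ α})
    (fun N => (isClopen_vertex_mem N α).2.preimage continuous_subtype_val)
    (fun p _ => by
      obtain ⟨N, hN⟩ := Set.mem_iUnion.1 ((hx.classPaths_eq_iUnion hlam).subset p.2)
      exact Set.mem_iUnion.2 ⟨N, hN.2⟩)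
    (Monotone.directed_le fun m n hmn p hp => (hx.monotone_classPaths_inter hlam hmn ⟨p.2, hp⟩).2)
  have hCN : C ∩ {p | p.vertex N ∈ α} ∩ B.classPaths α = C ∩ B.classPaths α :=
    subset_antisymm (fun p hp => ⟨hp.1.1, hp.2⟩)
      fun p hp => ⟨⟨hp.1, hN (show (⟨p, hp.2⟩ : B.classPaths α) ∈ _ from hp.1)⟩, hp.2⟩
  rw [← measure_inter_classPaths hnull, ← hCN, measure_inter_classPaths hnull]
  refine hμ.measure_mem_weightMonoid (hC.inter (isClopen_vertex_mem N α)) N fun p hp n hn => ?_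
  exact or_iff_not_imp_right.2 fun h => hx.mem_of_access hp.2 (access_vertex p hn) h

lemma IsMeasureOf.measure_vertex_zero (hμ : B.IsMeasureOf lam x μ) (v : V) :
    μ {p | p.vertex 0 = v} = ENNReal.ofReal (x v) := by
  obtain ⟨p, hp, -⟩ := exists_path_from (B := B) (S := Set.univ)
    (fun v _ => (B.exists_out v).imp fun w hw => ⟨trivial, hw⟩) (Set.mem_univ v)
  have : {p : B.Path | p.vertex 0 = v} = cylinder p 0 := by
    ext q; simp [cylinder, hp]
  rw [this, hμ, hp, pow_zero, div_one]

/-- If `μ` is good on `ωX_α`, the weight of the vertex outside `α` is a sum of weights of cylinders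
ending in `α`. -/
lemma ofReal_mem_weightMonoid (hx : B.IsDistinguished α lam x) (hlam : 0 < lam)
    (hμ : B.IsMeasureOf lam x μ) (hnull : μ (B.classPaths α)ᶜ = 0)
    (hgood : IsGoodMeasure (B.onePointExtension α μ)) (hv₁ : v₁ ∉ α)
    (hs : {v | x v ≠ 0} = insert v₁ α) :
    ENNReal.ofReal (x v₁) ∈ weightMonoid lam x α := by
  have := hμ.isFiniteMeasure
  have := hx.t2Space_onePoint hlam
  have hY := hx.measurableSet_classPaths hlam
  have hD := isClopen_vertex_mem (B := B) 0 α
  have hDc : IsCompact ({p : B.Path | p.vertex 0 ∈ α} ∩ B.classPaths α) := by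
    simpa using hx.isCompact_inter (B := B) hlam isClopen_univ 0
  have hK : IsClopen (B.pathLift α {p | p.vertex 0 ∈ α})ᶜ :=
    IsClopen.compl ⟨(isCompact_pathLift hDc).isClosed, isOpen_pathLift hD⟩
  have htrace : {p | p.vertex 0 ∈ α}ᶜ ∩ B.classPaths α =
      B.pathTrace α (B.pathLift α {p | p.vertex 0 ∈ α})ᶜ := by
    ext p
    simp only [pathTrace, pathLift, Set.mem_inter_iff, Set.mem_compl_iff, Set.mem_image,
      Set.mem_preimage, Subtype.exists, exists_and_right, exists_eq_right, Set.mem_ofPred_eq,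
      OnePoint.coe_eq_coe]
    by_cases hp : p ∈ B.classPaths α <;> simp_all
  -- Up to a null set, the paths not starting in `α` start at `v₁`.
  have hval : B.onePointExtension α μ (B.pathLift α {p | p.vertex 0 ∈ α})ᶜ =
      ENNReal.ofReal (x v₁) := by
    rw [onePointExtension_eq_measure hY hnull hK.2 htrace, ← hμ.measure_vertex_zero]
    refine le_antisymm ?_ (measure_mono fun p (hp : p.vertex 0 = v₁) hpα => hv₁ (hp ▸ hpα))
    refine (measure_mono (t := {p | p.vertex 0 = v₁} ∪ {p | ∃ n, x (p.vertex n) = 0})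
      fun p hp => ?_).trans ((measure_union_le _ _).trans_eq (by
        rw [hμ.measure_vertex_eq_zero, add_zero]))
    by_cases h0 : x (p.vertex 0) = 0
    · exact Or.inr ⟨0, h0⟩
    · have : p.vertex 0 ∈ {v | x v ≠ 0} := h0
      rw [hs] at this
      exact Or.inl (this.resolve_right hp)
  have hlt : B.onePointExtension α μ (B.pathLift α {p | p.vertex 0 ∈ α})ᶜ < μ Set.univ := by
    rw [onePointExtension_eq_measure hY hnull hK.2 htrace,
      ← measure_add_measure_compl hD.2.measurableSet, add_comm]
    refine ENNReal.lt_add_right (measure_ne_top _ _) ?_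
    obtain ⟨v, hv⟩ := hx.nonempty
    refine ((ENNReal.ofReal_pos.2 (hx.pos_of_mem hv)).trans_le ?_).ne'
    rw [← hμ.measure_vertex_zero]
    exact measure_mono fun p (hp : p.vertex 0 = v) => show p.vertex 0 ∈ α from hp ▸ hv
  -- This neighbourhood of infinity is replaced by a set of equal measure that is compact in `X_α`,
  -- whose measure involves weights of `α` only.
  obtain ⟨W, -, hW, hWc, hμW⟩ := exists_isClopen_subset hx hlam hnull hgood isClopen_univ
    hK.1.isCompact hK.2 hlt
  rw [← hval, ← hμW]
  exact hμ.measure_mem_weightMonoid_of_isCompact hx hlam hnull hW hWc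

end Compactification

end StationaryBratteliDiagram

/-! ### The equivalence. -/

theorem proposition4p1 {V : Type*} [Fintype V] (B : StationaryBratteliDiagram V)
    (lam : ℝ) (x : V → ℝ) (α : Set V) (hx : B.IsDistinguished α lam x)
    (v₁ : V) (hv₁ : v₁ ∉ α) (hsupp : {v | x v ≠ 0} = insert v₁ α)
    (μ : MeasureTheory.Measure B.Path) (hμ : B.IsMeasureOf lam x μ) :
    IsGoodMeasure μ ↔ IsGoodMeasure (B.onePointExtension α μ) := by
  open StationaryBratteliDiagram in
  have hlam : 0 < lam := (Nat.cast_nonneg _).trans_lt (hx.loops_lt hv₁ hsupp)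
  have hY := hx.measurableSet_classPaths hlam
  have hnull := hμ.measure_compl_classPaths hx hv₁ hsupp
  constructor
  · intro hgood K hKc hKo L hLc hLo hlt
    obtain ⟨C, hC, hCK⟩ := hx.exists_isClopen_inter_eq hlam hKc hKo
    obtain ⟨D, hD, hDL⟩ := hx.exists_isClopen_inter_eq hlam hLc hLo
    rw [onePointExtension_eq_measure hY hnull hKo hCK,
      onePointExtension_eq_measure hY hnull hLo hDL] at hlt
    -- The strict inequality leaves room to shrink `C` to a late piece, which makes `W` compact in
    -- `X_α`.
    obtain ⟨N, hN⟩ := hx.exists_lt_measure_inter hlam hnull hlt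
    have hCN := hC.inter (isClopen_vertex_mem N α)
    obtain ⟨W, hWc, hWo, hsub, hW⟩ :=
      hgood _ hCN.1.isCompact hCN.2 D hD.1.isCompact hD.2 hN
    have hWcl : IsClopen W := ⟨hWc.isClosed, hWo⟩
    refine ⟨B.pathLift α W, isCompact_pathLift ?_, isOpen_pathLift hWcl, pathLift_subset ?_, ?_⟩
    · have : W ∩ {p | p.vertex N ∈ α} = W := Set.inter_eq_left.2 fun p hp => (hsub hp).2
      rw [← this]
      exact hx.isCompact_inter hlam hWcl N
    · exact hCK ▸ Set.inter_subset_inter_left _ (hsub.trans Set.inter_subset_left)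
    · rw [onePointExtension_pathLift hY hnull hWcl, hW,
        onePointExtension_eq_measure hY hnull hLo hDL]
  · intro hgood C hCc hCo D hDc hDo hlt
    have hC : IsClopen C := ⟨hCc.isClosed, hCo⟩
    have hD : IsClopen D := ⟨hDc.isClosed, hDo⟩
    -- Measures of arbitrary clopen sets thereby become values attainable inside `X_α`.
    have hle : weightMonoid lam x (insert v₁ α) ≤ weightMonoid lam x α := by
      refine AddSubmonoid.closure_le.2 ?_
      rintro _ ⟨v, rfl | hv, k, rfl⟩
      · have h := div_pow_mem_weightMonoid hlam
          (ofReal_mem_weightMonoid hx hlam hμ hnull hgood hv₁ hsupp) k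
        rwa [← ENNReal.ofReal_mul (by positivity), one_div_mul_eq_div] at h
      · exact mem_weightMonoid hv k
    have hmem : μ D ∈ weightMonoid lam x α := hle <| hμ.measure_mem_weightMonoid hD 0
      fun p _ n _ => or_iff_not_imp_right.2 fun h => hsupp.subset h
    obtain ⟨E, hE, hEc, hμE⟩ := exists_isClopen_of_mem_weightMonoid hx hlam hμ hnull hgood hmem
      (hlt.trans_le (measure_mono (Set.subset_univ C)))
    have hval : B.onePointExtension α μ (B.pathLift α E) = μ D := by
      rw [onePointExtension_pathLift hY hnull hE, hμE]
    obtain ⟨W, hWC, hW, -, hμW⟩ := exists_isClopen_subset hx hlam hnull hgood hC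
      (isCompact_pathLift hEc) (isOpen_pathLift hE) (hval ▸ hlt)
    exact ⟨W, hW.1.isCompact, hW.2, hWC, hμW.trans hval⟩
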